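/- Let $\mathbb H^d$ be the real vector space of self-adjoint $d\times d$ complex matrices, with the Frobenius inner product $\langle A,B\rangle=\operatorname{tr}(A^*B)$ and norm $\|A\|_{\mathrm F}=\sqrt{\operatorname{tr}(A^*A)}$, and let $\|\cdot\|$ be the operator norm. For $f:\mathbb R\to\mathbb R$ and $A=V\operatorname{diag}(\lambda_1,\dots,\lambda_d)V^*\in\mathbb H^d$ with $V$ unitary, put $f(A)=V\operatorname{diag}(f(\lambda_1),\dots,f(\lambda_d))V^*$. Define $$\psi(x)=\begin{cases}1/2,&x>1,\\ x-\operatorname{sign}(x)\,x^2/2,&|x|\le 1,\\ -1/2,&x<-1,\end{cases}\qquad \Psi(x)=\begin{cases}\frac{x^2}{2}-\frac{|x|^3}{6},&|x|\le 1,\\ \frac13+\frac12(|x|-1),&|x|>1.\end{cases}$$ Let $m\le n$, let $S$ be a set, $H:S^m\to\mathbb H^d$ a function, $X_1,\dots,X_n\in S$ (for instance a realization of a random sample), and $\theta>0$. Let $I_n^m$ be the set of $m$-tuples of pairwise distinct elements of $\{1,\dots,n\}$, write $H_{i_1\ldots i_m}=H(X_{i_1},\dots,X_{i_m})$, and consider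 the problem $$\text{minimize}\quad \operatorname{tr}\Big[\sum_{(i_1,\ldots,i_m)\in I_n^m}\Psi\big(\theta(H_{i_1\ldots i_m}-U)\big)\Big]\quad\text{over } U\in\mathbb H^d, \tag{P}$$ whose solutions are denoted $\widehat U_n^\star$. Set $$F_\theta(U)=\frac1{\theta^2}\frac{(n-m)!}{n!}\operatorname{tr}\Big[\sum_{(i_1,\ldots,i_m)\in I_n^m}\Psi\big(\theta(H_{i_1\ldots i_m}-U)\big)\Big],\qquad U\in\mathbb H^d.$$ Then: 1. Problem (P) is a convex optimization problem, i.e. its objective is a convex function on $\mathbb H^d$. 2. $F_\theta$ is differentiable on $\mathbb H^d$, and its gradient with respect to the Frobenius inner product is $$\nabla F_\theta(U)=-\frac1\theta\frac{(n-m)!}{n!}\sum_{(i_1,\ldots,i_m)\in I_n^m}\psi\big(\theta(H_{i_1\ldots i_m}-U)\big).$$ Moreover, for all $U,V\in\mathbb H^d$, $\|\nabla F_\theta(U)-\nabla F_\theta(V)\|_{\mathrm F}\le\|U-V\|_{\mathrm F}$ and $\|\nabla F_\theta(U)-\nabla F_\theta(V)\|\le\|U-V\|$. 3. A matrix $\widehat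 U_n^\star\in\mathbb H^d$ is a solution of (P) if and only if $$\sum_{(i_1,\ldots,i_m)\in I_n^m}\psi\big(\theta(H_{i_1\ldots i_m}-\widehat U_n^\star)\big)=0_{d\times d}.$$ -/

import Mathlib

noncomputable section

namespace RobustU

/-- The truncation function `ψ`. -/
def psi (x : ℝ) : ℝ :=
  if 1 < x then 1 / 2
  else if x < -1 then -(1 / 2)
  else x - Real.sign x * x ^ 2 / 2

/-- The loss function `Ψ`. -/
def Psi (x : ℝ) : ℝ :=
  if |x| ≤ 1 then x ^ 2 / 2 - |x| ^ 3 / 6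
  else 1 / 3 + 1 / 2 * (|x| - 1)

/-- The real vector space of self-adjoint `d × d` complex matrices. -/
abbrev Herm (d : ℕ) : Type := selfAdjoint (Matrix (Fin d) (Fin d) ℂ)

/-- The Frobenius norm on self-adjoint matrices. -/
instance instNormedAddCommGroupHerm (d : ℕ) : NormedAddCommGroup (Herm d) :=
  letI : NormedAddCommGroup (Matrix (Fin d) (Fin d) ℂ) := Matrix.frobeniusNormedAddCommGroup
  AddSubgroup.normedAddCommGroup

/-- The Frobenius norm squared is `tr (A* A)`. -/
theorem norm_sq_eq_trace (d : ℕ) (A : Herm d) :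
    ‖A‖ ^ 2 = (Matrix.trace (Matrix.conjTranspose A.1 * A.1)).re := by
  let _ : NormedAddCommGroup (Matrix (Fin d) (Fin d) ℂ) := Matrix.frobeniusNormedAddCommGroup
  have h : ‖A‖ = (∑ i, ∑ j, ‖A.1 i j‖ ^ (2 : ℝ)) ^ (1 / 2 : ℝ) :=
    Matrix.frobenius_norm_def A.1
  rw [h, ← Real.sqrt_eq_rpow, Real.sq_sqrt (by positivity), Finset.sum_comm]
  simp only [Matrix.trace, Matrix.diag, Matrix.mul_apply, Matrix.conjTranspose_apply,
    Complex.re_sum]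
  refine Finset.sum_congr rfl fun i _ => Finset.sum_congr rfl fun j _ => ?_
  simp [Complex.sq_norm, Complex.normSq_apply]

/-- The Frobenius inner product `⟨A, B⟩ = tr (A* B)` on self-adjoint matrices,
on which it is real-valued. -/
instance instInnerProductSpaceHerm (d : ℕ) : InnerProductSpace ℝ (Herm d) :=
  letI : NormedAddCommGroup (Matrix (Fin d) (Fin d) ℂ) := Matrix.frobeniusNormedAddCommGroup
  letI : NormedSpace ℝ (Matrix (Fin d) (Fin d) ℂ) := Matrix.frobeniusNormedSpace
  { norm_smul_le := fun r A => norm_smul_le r A.1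
    inner := fun A B => (Matrix.trace (Matrix.conjTranspose A.1 * B.1)).re
    norm_sq_eq_re_inner := fun A => norm_sq_eq_trace d A
    conj_inner_symm := fun A B => by
      have h : Matrix.conjTranspose A.1 * B.1
          = Matrix.conjTranspose (Matrix.conjTranspose B.1 * A.1) := by
        simp [Matrix.conjTranspose_mul]
      change (Matrix.trace (Matrix.conjTranspose B.1 * A.1)).re
        = (Matrix.trace (Matrix.conjTranspose A.1 * B.1)).re
      rw [h, Matrix.trace_conjTranspose]
      simp
    add_left := fun A B C => by
      simp [Matrix.conjTranspose_add, add_mul, Matrix.trace_add]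
    smul_left := fun A B r => by
      simp [Matrix.conjTranspose_smul, Matrix.trace_smul] }

instance instCompleteSpaceHerm (d : ℕ) :
    @CompleteSpace (Herm d) (instNormedAddCommGroupHerm d).toPseudoMetricSpace.toUniformSpace := by
  have : IsClosed {A : Matrix (Fin d) (Fin d) ℂ | star A = A} :=
    isClosed_eq continuous_star continuous_id
  exact this.isComplete.completeSpace_coe

/-- The operator norm of a self-adjoint matrix acting on Euclidean space. -/
def opNorm {d : ℕ} (A : Herm d) : ℝ :=
  ‖Matrix.toEuclideanCLM (n := Fin d) (𝕜 := ℂ) A.1‖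

/-- The matrix function `f(A) = V f(Λ) V*` for `A = V Λ V*`: Mathlib's functional calculus. -/
def matFun {d : ℕ} (f : ℝ → ℝ) (A : Herm d) : Herm d :=
  ⟨cfc f A.1, cfc_predicate f A.1⟩

/-- The functional calculus is given by diagonalization. -/
theorem matFun_eq {d : ℕ} (f : ℝ → ℝ) (A : Herm d) (hA : A.1.IsHermitian) :
    (matFun f A).1 = (hA.eigenvectorUnitary : Matrix (Fin d) (Fin d) ℂ)
      * Matrix.diagonal (fun i => ((f (hA.eigenvalues i) : ℝ) : ℂ))
      * star (hA.eigenvectorUnitary : Matrix (Fin d) (Fin d) ℂ) :=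
  hA.cfc_eq f

/-- The trace of a self-adjoint matrix, as a real number. -/
def htrace {d : ℕ} (A : Herm d) : ℝ := (Matrix.trace A.1).re

/-- `htrace` is the usual trace. -/
theorem coe_htrace {d : ℕ} (A : Herm d) : ((htrace A : ℝ) : ℂ) = Matrix.trace A.1 := by
  refine Complex.conj_eq_iff_re.mp ?_
  have h : star (Matrix.trace A.1) = Matrix.trace A.1 := by
    rw [← Matrix.trace_conjTranspose]
    exact congrArg Matrix.trace A.2
  exact h

/-- The value `H (x_{i_1}, …, x_{i_m})`; an injective multi-index `(i_1, …, i_m)` is an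
embedding of `Fin m` in `Fin n`. -/
def kernelAt {S : Type*} {m n d : ℕ} (H : (Fin m → S) → Herm d) (x : Fin n → S)
    (i : Fin m ↪ Fin n) : Herm d :=
  H fun j => x (i j)

/-- The objective function of the optimization problem that defines the estimator. -/
def objective {S : Type*} {m n d : ℕ} (H : (Fin m → S) → Herm d) (x : Fin n → S) (θ : ℝ)
    (U : Herm d) : ℝ :=
  htrace (∑ i : Fin m ↪ Fin n, matFun Psi (θ • (kernelAt H x i - U)))

/-- The normalized objective `F_θ`. -/
def F {S : Type*} {m n d : ℕ} (H : (Fin m → S) → Herm d) (x : Fin n → S) (θ : ℝ)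
    (U : Herm d) : ℝ :=
  1 / θ ^ 2 * (((n - m).factorial : ℝ) / (n.factorial : ℝ)) *
    htrace (∑ i : Fin m ↪ Fin n, matFun Psi (θ • (kernelAt H x i - U)))

/-- `U` is a solution of the problem that defines the estimator: a minimizer of the objective
over all self-adjoint matrices. -/
def IsEstimator {S : Type*} {m n d : ℕ} (H : (Fin m → S) → Herm d) (x : Fin n → S) (θ : ℝ)
    (U : Herm d) : Prop :=
  ∀ V : Herm d, objective H x θ U ≤ objective H x θ V

end RobustU

end

/-!
Pairing the eigenbases of `A` and `B` turns traces such as `tr (f(A) g(B))` into nonnegatively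
weighted sums over pairs `(x, y)` of eigenvalues, so that a scalar inequality in `x` and `y` becomes
a trace inequality. The tangent line inequality of the convex function `Ψ` becomes Klein's
inequality, which says that `ψ(B)` is a subgradient of `tr Ψ` at `B`; the second-order Taylor bound
shows that it is the gradient, and `|ψ x - ψ y| ≤ |x - y|` gives the Lipschitz bound in the
Frobenius norm.

For the operator norm, `ψ(A) - ψ(B)` is, in the pair of eigenbases, the entrywise product of `A - B`
with the divided differences of `ψ`. These are averages of the triangle function
`ψ' x = max 0 (1 - |x|)`, which at `a - b` is the length of `[a, a + 1] ∩ [b, b + 1]`; the divided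
differences are therefore inner products `⟪αₓ, β_y⟫` of unit vectors in `L²(ℝ²)`, and multiplication
by such a kernel is a contraction for the operator norm.
-/

namespace RobustU

open Set MeasureTheory

section ConvexAnalysis

theorem convexOn_of_exists_subgradient {E : Type*} [AddCommGroup E] [Module ℝ E] {s : Set E}
    {f : E → ℝ} (hs : Convex ℝ s)
    (h : ∀ u ∈ s, ∃ l : E →ₗ[ℝ] ℝ, ∀ v ∈ s, f u + l (v - u) ≤ f v) : ConvexOn ℝ s f := by
  refine ⟨hs, fun u hu v hv a b ha hb hab => ?_⟩
  obtain ⟨l, hl⟩ := h _ (hs hu hv ha hb hab)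
  set w := a • u + b • v
  have hw : a • (u - w) + b • (v - w) = 0 := by
    have : a • (u - w) + b • (v - w) = w - (a + b) • w := by module
    rw [this, hab, one_smul, sub_self]
  have hl0 : a * l (u - w) + b * l (v - w) = 0 := by
    simpa only [map_add, map_smul, smul_eq_mul, map_zero] using congrArg l hw
  calc f w = a * (f w + l (u - w)) + b * (f w + l (v - w)) := by
        linear_combination -f w * hab - hl0
    _ ≤ a * f u + b * f v := by gcongr <;> grind

theorem convexOn_sum {E ι : Type*} [AddCommGroup E] [Module ℝ E] {s : Set E} (t : Finset ι)
    {f : ι → E → ℝ} (hs : Convex ℝ s) (hf : ∀ i ∈ t, ConvexOn ℝ s (f i)) :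
    ConvexOn ℝ s fun u => ∑ i ∈ t, f i u := by
  rw [← Finset.sum_fn]
  exact Finset.sum_induction f (ConvexOn ℝ s) (fun _ _ => ConvexOn.add) (convexOn_const 0 hs) hf

theorem add_rightDeriv_mul_sub_le {f : ℝ → ℝ} (hf : ConvexOn ℝ univ f) (x y : ℝ) :
    f y + derivWithin f (Ioi y) y * (x - y) ≤ f x := by
  have hy : y ∈ interior univ := by simp
  rcases lt_trichotomy x y with hxy | rfl | hxy
  · have h := (hf.slope_le_leftDeriv_of_mem_interior (mem_univ x) hy hxy).trans
      (hf.leftDeriv_le_rightDeriv_of_mem_interior hy)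
    rw [slope_def_field, div_le_iff₀ (sub_pos.2 hxy)] at h
    linarith
  · simp
  · have h := hf.rightDeriv_le_slope_of_mem_interior hy (mem_univ x) hxy
    rw [slope_def_field, le_div_iff₀ (sub_pos.2 hxy)] at h
    linarith

theorem abs_sub_sub_mul_le_of_lipschitzWith {f f' : ℝ → ℝ} {K : NNReal}
    (hf : ∀ x, HasDerivAt f (f' x) x) (hf' : LipschitzWith K f') (x y : ℝ) :
    |f x - f y - f' y * (x - y)| ≤ K * (x - y) ^ 2 := by
  have hderiv : ∀ z ∈ uIcc y x,
      HasDerivWithinAt (fun z => f z - f' y * z) (f' z - f' y) (uIcc y x) z := fun z _ =>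
    ((hf z).sub (((hasDerivAt_id z).const_mul (f' y)).congr_deriv (mul_one _))).hasDerivWithinAt
  have hbound : ∀ z ∈ uIcc y x, ‖f' z - f' y‖ ≤ K * |x - y| := fun z hz =>
    (hf'.norm_sub_le z y).trans
      (mul_le_mul_of_nonneg_left (abs_sub_left_of_mem_uIcc hz) K.2)
  have h := (convex_uIcc y x).norm_image_sub_le_of_norm_hasDerivWithin_le hderiv hbound
    left_mem_uIcc right_mem_uIcc
  calc |f x - f y - f' y * (x - y)| = ‖f x - f' y * x - (f y - f' y * y)‖ := by
        rw [Real.norm_eq_abs]; congr 1; ring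
    _ ≤ K * |x - y| * ‖x - y‖ := h
    _ = K * (x - y) ^ 2 := by rw [Real.norm_eq_abs, mul_assoc, abs_mul_abs_self, sq]

variable {E : Type*} [NormedAddCommGroup E] [InnerProductSpace ℝ E] [CompleteSpace E]
  {f : E → ℝ} {g u : E}

theorem hasGradientAt_of_abs_sub_sub_inner_le {C : ℝ}
    (h : ∀ v, |f v - f u - inner ℝ g (v - u)| ≤ C * ‖v - u‖ ^ 2) : HasGradientAt f g u := by
  rw [hasGradientAt_iff_isLittleO]
  have hO : (fun v => f v - f u - inner ℝ g (v - u)) =O[nhds u] fun v => ‖v - u‖ ^ 2 :=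
    .of_bound C (.of_forall fun v => by simpa using h v)
  have ho : (fun v => ‖v - u‖ ^ 2) =o[nhds u] fun v => v - u :=
    (Asymptotics.isLittleO_pow_sub_sub u one_lt_two)
  exact hO.trans_isLittleO ho

theorem add_inner_le_of_convexOn (hf : ConvexOn ℝ univ f) (hg : HasGradientAt f g u) (v : E) :
    f u + inner ℝ g (v - u) ≤ f v := by
  have hline : HasDerivAt (f ∘ AffineMap.lineMap (k := ℝ) u v) (inner ℝ g (v - u)) 0 := by
    have hg' : HasFDerivAt f (InnerProductSpace.toDual ℝ E g)
        (AffineMap.lineMap (k := ℝ) u v 0) := by simpa using hg.hasFDerivAt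
    exact hg'.comp_hasDerivAt 0 AffineMap.hasDerivAt_lineMap
  have hslope := (hf.comp_affineMap (AffineMap.lineMap (k := ℝ) u v)).le_slope_of_hasDerivAt
    (mem_univ 0) (mem_univ 1) one_pos hline
  simp only [slope_def_field, Function.comp_apply, AffineMap.lineMap_apply_one,
    AffineMap.lineMap_apply_zero, sub_zero, div_one] at hslope
  linarith

theorem forall_le_iff_gradient_eq_zero (hf : ConvexOn ℝ univ f) (hg : HasGradientAt f g u) :
    (∀ v, f u ≤ f v) ↔ g = 0 := by
  constructor
  · intro hmin
    have hlocal : IsLocalMin f u := .of_forall hmin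
    simpa using hlocal.hasFDerivAt_eq_zero hg.hasFDerivAt
  · rintro rfl v
    simpa using add_inner_le_of_convexOn hf hg v

theorem hasGradientAt_comp_smul_sub {θ : ℝ} {a : E} (hg : HasGradientAt f g (θ • (a - u))) :
    HasGradientAt (fun v => f (θ • (a - v))) (-(θ • g)) u := by
  rw [hasGradientAt_iff_hasFDerivAt]
  refine (hg.hasFDerivAt.comp u (((hasFDerivAt_id u).const_sub a).const_smul θ)).congr_fderiv ?_
  ext v
  simp

theorem hasGradientAt_sum {ι : Type*} [Fintype ι] {f : ι → E → ℝ} {g : ι → E}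
    (hg : ∀ i, HasGradientAt (f i) (g i) u) :
    HasGradientAt (fun v => ∑ i, f i v) (∑ i, g i) u := by
  rw [hasGradientAt_iff_hasFDerivAt, map_sum]
  exact .fun_sum fun i _ => (hg i).hasFDerivAt

theorem hasGradientAt_const_mul (c : ℝ) (hg : HasGradientAt f g u) :
    HasGradientAt (fun v => c * f v) (c • g) u := by
  rw [hasGradientAt_iff_hasFDerivAt, map_smul]
  exact hg.hasFDerivAt.const_mul c

end ConvexAnalysis

section JointSpectrum

open Matrix RCLike

variable {𝕜 n : Type*} [RCLike 𝕜] [Fintype n] [DecidableEq n] {A B : Matrix n n 𝕜}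
  (hA : A.IsHermitian) (hB : B.IsHermitian)

/-- The change of basis between the eigenbases of two Hermitian matrices. -/
noncomputable def eigenbasisOverlap : Matrix n n 𝕜 :=
  star (hA.eigenvectorUnitary : Matrix n n 𝕜) * hB.eigenvectorUnitary

/-- The sum of a function of two variables over pairs of eigenvalues of two Hermitian matrices,
weighted by the squared moduli of the inner products of the eigenvectors. It expresses the traces
of products `f(A) g(B)`, even if `A` and `B` do not commute. -/
noncomputable def jointSpectralSum (k : ℝ → ℝ → ℝ) : ℝ :=
  ∑ i, ∑ j, ‖eigenbasisOverlap hA hB i j‖ ^ 2 * k (hA.eigenvalues i) (hB.eigenvalues j)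

theorem jointSpectralSum_mono {k l : ℝ → ℝ → ℝ} (h : ∀ x y, k x y ≤ l x y) :
    jointSpectralSum hA hB k ≤ jointSpectralSum hA hB l :=
  Finset.sum_le_sum fun _ _ => Finset.sum_le_sum fun _ _ =>
    mul_le_mul_of_nonneg_left (h _ _) (sq_nonneg _)

theorem abs_jointSpectralSum_le {k l : ℝ → ℝ → ℝ} (h : ∀ x y, |k x y| ≤ l x y) :
    |jointSpectralSum hA hB k| ≤ jointSpectralSum hA hB l := by
  have hneg : -jointSpectralSum hA hB k = jointSpectralSum hA hB fun x y => -k x y := by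
    simp only [jointSpectralSum, mul_neg, Finset.sum_neg_distrib]
  refine abs_le'.2 ⟨jointSpectralSum_mono hA hB fun x y => (le_abs_self _).trans (h x y), ?_⟩
  exact hneg.trans_le (jointSpectralSum_mono hA hB fun x y => (neg_le_abs _).trans (h x y))

theorem jointSpectralSum_sub (k l : ℝ → ℝ → ℝ) :
    jointSpectralSum hA hB (fun x y => k x y - l x y) =
      jointSpectralSum hA hB k - jointSpectralSum hA hB l := by
  simp only [jointSpectralSum, mul_sub, Finset.sum_sub_distrib]

theorem jointSpectralSum_add (k l : ℝ → ℝ → ℝ) :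
    jointSpectralSum hA hB (fun x y => k x y + l x y) =
      jointSpectralSum hA hB k + jointSpectralSum hA hB l := by
  simp only [jointSpectralSum, mul_add, Finset.sum_add_distrib]

theorem jointSpectralSum_const_mul (c : ℝ) (k : ℝ → ℝ → ℝ) :
    jointSpectralSum hA hB (fun x y => c * k x y) = c * jointSpectralSum hA hB k := by
  simp only [jointSpectralSum, Finset.mul_sum, mul_left_comm]

theorem star_eigenvectorUnitary_mul_cfc (f : ℝ → ℝ) :
    star (hA.eigenvectorUnitary : Matrix n n 𝕜) * cfc f A =
      diagonal (fun i => (f (hA.eigenvalues i) : 𝕜)) *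
        star (hA.eigenvectorUnitary : Matrix n n 𝕜) := by
  rw [hA.cfc_eq, Matrix.IsHermitian.cfc, Unitary.conjStarAlgAut_apply]
  simp only [← mul_assoc, Unitary.coe_star_mul_self, one_mul]
  rfl

theorem cfc_mul_eigenvectorUnitary (f : ℝ → ℝ) :
    cfc f A * (hA.eigenvectorUnitary : Matrix n n 𝕜) =
      hA.eigenvectorUnitary * diagonal (fun i => (f (hA.eigenvalues i) : 𝕜)) := by
  rw [hA.cfc_eq, Matrix.IsHermitian.cfc, Unitary.conjStarAlgAut_apply]
  simp only [mul_assoc, Unitary.coe_star_mul_self, mul_one]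
  rfl

theorem star_eigenvectorUnitary_mul_cfc_sub_mul_eigenvectorUnitary (f g : ℝ → ℝ) :
    star (hA.eigenvectorUnitary : Matrix n n 𝕜) * (cfc f A - cfc g B) * hB.eigenvectorUnitary =
      of fun i j => ((f (hA.eigenvalues i) - g (hB.eigenvalues j) : ℝ) : 𝕜) *
        eigenbasisOverlap hA hB i j := by
  rw [mul_sub, sub_mul, star_eigenvectorUnitary_mul_cfc, mul_assoc _ (cfc g B),
    cfc_mul_eigenvectorUnitary, mul_assoc, ← mul_assoc (star _), ← eigenbasisOverlap]
  ext i j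
  rw [Matrix.sub_apply, diagonal_mul, mul_diagonal, of_apply]
  push_cast
  ring

theorem re_trace_cfc_mul_cfc (f g : ℝ → ℝ) :
    re (trace (cfc f A * cfc g B)) = jointSpectralSum hA hB fun x y => f x * g y := by
  set V := (hA.eigenvectorUnitary : Matrix n n 𝕜) with hV
  set W := (hB.eigenvectorUnitary : Matrix n n 𝕜) with hW
  have hVV : V * star V = 1 := Unitary.coe_mul_star_self _
  have hWW : W * star W = 1 := Unitary.coe_mul_star_self _
  have htrace : trace (cfc f A * cfc g B) =
      trace (star V * cfc f A * (cfc g B * W) * star (star V * W)) := by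
    calc trace (cfc f A * cfc g B) = trace ((V * star V) * cfc f A * cfc g B * (W * star W)) := by
          rw [hVV, hWW, one_mul, mul_one]
      _ = _ := by
          simp only [star_mul, star_star, mul_assoc]
          rw [trace_mul_comm V]
          simp only [mul_assoc]
  rw [htrace, star_eigenvectorUnitary_mul_cfc, cfc_mul_eigenvectorUnitary,
    mul_assoc (Matrix.diagonal _), ← mul_assoc (star _), ← hV, ← hW,
    ← mul_assoc (Matrix.diagonal _), jointSpectralSum, trace, map_sum]
  refine Finset.sum_congr rfl fun i _ => ?_
  rw [diag_apply, mul_apply, map_sum]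
  refine Finset.sum_congr rfl fun j _ => ?_
  rw [mul_diagonal, diagonal_mul, star_apply, eigenbasisOverlap, ← hV, ← hW]
  have hcast (a b : ℝ) (z : 𝕜) : a * z * b * star z = ((‖z‖ ^ 2 * (a * b) : ℝ) : 𝕜) := by
    push_cast
    rw [← mul_conj, starRingEnd_apply]
    ring
  rw [hcast, ofReal_re]

theorem re_trace_cfc_left (f : ℝ → ℝ) :
    re (trace (cfc f A)) = jointSpectralSum hA hB fun x _ => f x := by
  have h := re_trace_cfc_mul_cfc hA hB f fun _ => 1
  have hone : cfc (fun _ : ℝ => (1 : ℝ)) B = 1 := cfc_const_one ℝ B hB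
  simpa only [hone, mul_one] using h

theorem re_trace_cfc_right (f : ℝ → ℝ) :
    re (trace (cfc f B)) = jointSpectralSum hA hB fun _ y => f y := by
  have h := re_trace_cfc_mul_cfc hA hB (fun _ => 1) f
  have hone : cfc (fun _ : ℝ => (1 : ℝ)) A = 1 := cfc_const_one ℝ A hA
  simpa only [hone, one_mul] using h

theorem cfc_mul_cfc (f g : ℝ → ℝ) (A : Matrix n n 𝕜) :
    cfc f A * cfc g A = cfc (fun x => f x * g x) A :=
  (cfc_mul f g A (finite_real_spectrum.continuousOn f) (finite_real_spectrum.continuousOn g)).symm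

theorem re_trace_cfc_sub_cfc_mul_self (f : ℝ → ℝ) :
    re (trace ((cfc f A - cfc f B) * (cfc f A - cfc f B))) =
      jointSpectralSum hA hB fun x y => (f x - f y) ^ 2 := by
  have hexpand : (fun x y => (f x - f y) ^ 2) =
      fun x y => f x * f x + f y * f y - 2 * (f x * f y) := by
    ext x y; ring
  rw [hexpand, jointSpectralSum_sub, jointSpectralSum_add, jointSpectralSum_const_mul,
    ← re_trace_cfc_mul_cfc, ← re_trace_cfc_left hA hB fun x => f x * f x,
    ← re_trace_cfc_right hA hB fun x => f x * f x, ← cfc_mul_cfc, ← cfc_mul_cfc]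
  simp only [mul_sub, sub_mul, trace_sub, map_sub, trace_mul_comm (cfc f B) (cfc f A)]
  ring

theorem re_trace_cfc_sub_sub_mul (f g : ℝ → ℝ) :
    re (trace (cfc f A)) - re (trace (cfc f B)) - re (trace (cfc g B * (A - B))) =
      jointSpectralSum hA hB fun x y => f x - f y - g y * (x - y) := by
  have hexpand : (fun x y => f x - f y - g y * (x - y)) =
      fun x y => f x - f y - (x * g y - y * g y) := by
    ext x y; ring
  have hleft : trace (cfc g B * A) = trace (cfc (fun x : ℝ => x) A * cfc g B) := by
    rw [cfc_id' ℝ A hA.isSelfAdjoint, trace_mul_comm]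
  have hright : cfc g B * B = cfc (fun y => y * g y) B := by
    have h := cfc_mul_cfc g (fun y => y) B
    rw [cfc_id' ℝ B hB.isSelfAdjoint] at h
    simpa only [mul_comm] using h
  rw [hexpand, mul_sub, trace_sub, map_sub, hleft, hright]
  simp only [jointSpectralSum_sub]
  rw [re_trace_cfc_left hA hB, re_trace_cfc_right hA hB, re_trace_cfc_right hA hB,
    re_trace_cfc_mul_cfc hA hB]

theorem klein_inequality (hA : A.IsHermitian) (hB : B.IsHermitian) {f g : ℝ → ℝ}
    (h : ∀ x y, f y + g y * (x - y) ≤ f x) :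
    re (trace (cfc f B)) + re (trace (cfc g B * (A - B))) ≤ re (trace (cfc f A)) := by
  have hpos : jointSpectralSum hA hB (fun _ _ => 0) ≤
      jointSpectralSum hA hB fun x y => f x - f y - g y * (x - y) :=
    jointSpectralSum_mono hA hB fun x y => by linarith [h x y]
  rw [← re_trace_cfc_sub_sub_mul] at hpos
  simp only [jointSpectralSum, mul_zero, Finset.sum_const_zero] at hpos
  linarith

end JointSpectrum

section SchurMultiplier

open Matrix
open scoped Matrix.Norms.L2Operator

variable {𝕜 m n E : Type*} [RCLike 𝕜] [Fintype m] [Fintype n] [DecidableEq n]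
  [NormedAddCommGroup E] [InnerProductSpace 𝕜 E]

theorem sum_norm_sq_mulVec_le (M : Matrix m n 𝕜) (y : n → 𝕜) :
    ∑ i, ‖(M *ᵥ y) i‖ ^ 2 ≤ ‖M‖ ^ 2 * ∑ j, ‖y j‖ ^ 2 := by
  have h := M.l2_opNorm_mulVec (WithLp.toLp 2 y)
  have := pow_le_pow_left₀ (norm_nonneg _) h 2
  rwa [mul_pow, EuclideanSpace.norm_sq_eq, EuclideanSpace.norm_sq_eq] at this

theorem sum_norm_sq_sum_smul_le (M : Matrix m n 𝕜) (ξ : n → E) :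
    ∑ i, ‖∑ j, M i j • ξ j‖ ^ 2 ≤ ‖M‖ ^ 2 * ∑ j, ‖ξ j‖ ^ 2 := by
  let W := Submodule.span 𝕜 (range ξ)
  have : FiniteDimensional 𝕜 W := FiniteDimensional.span_of_finite 𝕜 (finite_range ξ)
  let e := stdOrthonormalBasis 𝕜 W
  let η : n → W := fun j => ⟨ξ j, Submodule.subset_span (mem_range_self j)⟩
  have hη (i : m) : ‖∑ j, M i j • ξ j‖ = ‖∑ j, M i j • η j‖ := by
    rw [Submodule.coe_norm, Submodule.coe_sum]
    rfl
  have hξ (j : n) : ‖ξ j‖ = ‖η j‖ := rfl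
  simp only [hη, hξ, ← e.sum_sq_norm_inner_right]
  rw [Finset.sum_comm, Finset.sum_comm (s := (Finset.univ : Finset n)), Finset.mul_sum]
  refine Finset.sum_le_sum fun k _ => ?_
  refine (le_of_eq ?_).trans (sum_norm_sq_mulVec_le M fun j => inner 𝕜 (e k) (η j))
  simp only [inner_sum, inner_smul_right, mulVec, dotProduct]

theorem l2_opNorm_gram_schur_le (M : Matrix m n 𝕜) {α : m → E} {β : n → E} {a b : ℝ}
    (ha : 0 ≤ a) (hb : 0 ≤ b) (hα : ∀ i, ‖α i‖ ≤ a) (hβ : ∀ j, ‖β j‖ ≤ b) :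
    ‖of fun i j => inner 𝕜 (α i) (β j) * M i j‖ ≤ a * b * ‖M‖ := by
  rw [l2_opNorm_def]
  refine ContinuousLinearMap.opNorm_le_bound _ (by positivity) fun y => ?_
  refine le_of_sq_le_sq ?_ (by positivity)
  set ξ : n → E := fun j => y j • β j
  have hinner (i : m) : (of (fun i j => inner 𝕜 (α i) (β j) * M i j) *ᵥ y) i =
      inner 𝕜 (α i) (∑ j, M i j • ξ j) := by
    simp only [mulVec, dotProduct, of_apply, inner_sum, ξ, inner_smul_right]
    exact Finset.sum_congr rfl fun j _ => by ring
  have hα' (i : m) : ‖inner 𝕜 (α i) (∑ j, M i j • ξ j)‖ ^ 2 ≤ a ^ 2 * ‖∑ j, M i j • ξ j‖ ^ 2 := by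
    rw [← mul_pow]
    gcongr
    exact (norm_inner_le_norm _ _).trans (by gcongr; exact hα i)
  have hβ' (j : n) : ‖ξ j‖ ^ 2 ≤ b ^ 2 * ‖y j‖ ^ 2 := by
    rw [← mul_pow, norm_smul, mul_comm]
    gcongr
    exact hβ j
  rw [EuclideanSpace.norm_sq_eq]
  calc ∑ i, ‖(of (fun i j => inner 𝕜 (α i) (β j) * M i j) *ᵥ y) i‖ ^ 2
      ≤ ∑ i, a ^ 2 * ‖∑ j, M i j • ξ j‖ ^ 2 :=
        Finset.sum_le_sum fun i _ => (hinner i).symm ▸ hα' i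
    _ ≤ a ^ 2 * (‖M‖ ^ 2 * ∑ j, b ^ 2 * ‖y j‖ ^ 2) := by
        rw [← Finset.mul_sum]
        gcongr
        exact (sum_norm_sq_sum_smul_le M ξ).trans (by gcongr with j; exact hβ' j)
    _ = (a * b * ‖M‖ * ‖y‖) ^ 2 := by
        rw [← Finset.mul_sum, mul_pow, EuclideanSpace.norm_sq_eq]
        ring

theorem l2_opNorm_cfc_sub_cfc_le_of_gram {A B : Matrix n n 𝕜} (hA : A.IsHermitian)
    (hB : B.IsHermitian) {f : ℝ → ℝ} {α β : ℝ → E} {a b : ℝ} (hα : ∀ x, ‖α x‖ ≤ a)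
    (hβ : ∀ y, ‖β y‖ ≤ b)
    (hf : ∀ x y, ((f x - f y : ℝ) : 𝕜) = inner 𝕜 (α x) (β y) * ((x - y : ℝ) : 𝕜)) :
    ‖cfc f A - cfc f B‖ ≤ a * b * ‖A - B‖ := by
  have hrotate (g : ℝ → ℝ) : ‖of fun i j =>
      ((g (hA.eigenvalues i) - g (hB.eigenvalues j) : ℝ) : 𝕜) * eigenbasisOverlap hA hB i j‖ =
      ‖cfc g A - cfc g B‖ := by
    rw [← star_eigenvectorUnitary_mul_cfc_sub_mul_eigenvectorUnitary,
      CStarRing.norm_mul_coe_unitary, ← Unitary.coe_star, CStarRing.norm_coe_unitary_mul]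
  have h := l2_opNorm_gram_schur_le (of fun i j =>
      ((hA.eigenvalues i - hB.eigenvalues j : ℝ) : 𝕜) * eigenbasisOverlap hA hB i j)
    ((norm_nonneg _).trans (hα 0)) ((norm_nonneg _).trans (hβ 0))
    (fun i => hα (hA.eigenvalues i)) (fun j => hβ (hB.eigenvalues j))
  simp only [of_apply, ← mul_assoc, ← hf] at h
  rwa [hrotate f, hrotate fun x => x, cfc_id' ℝ A hA.isSelfAdjoint,
    cfc_id' ℝ B hB.isSelfAdjoint] at h

end SchurMultiplier
section TruncationFunction

theorem hasDerivAt_mul_abs (x : ℝ) : HasDerivAt (fun y : ℝ => y * |y|) (2 * |x|) x := by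
  have hne (y : ℝ) (hy : y ≠ 0) : HasDerivAt (fun y : ℝ => y * |y|) (2 * |y|) y :=
    ((hasDerivAt_id y).mul (hasDerivAt_abs hy)).congr_deriv <| by
      rw [one_mul, id, self_mul_sign, two_mul]
  exact hasDerivAt_of_hasDerivAt_of_ne' hne (by fun_prop) (by fun_prop) x

theorem hasDerivAt_abs_cube (x : ℝ) : HasDerivAt (fun y : ℝ => |y| ^ 3) (3 * (x * |x|)) x := by
  have hcube : (fun y : ℝ => |y| ^ 3) = fun y => y * (y * |y|) := by
    ext y
    rw [pow_succ, sq_abs]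
    ring
  rw [hcube]
  exact ((hasDerivAt_id x).mul (hasDerivAt_mul_abs x)).congr_deriv (by rw [id]; ring)

theorem psi_eq_abs (x : ℝ) :
    psi x = ((x + 1) * |x + 1| + (x - 1) * |x - 1| - 2 * (x * |x|)) / 4 := by
  have hsign : Real.sign x * x ^ 2 = x * |x| := by
    rcases lt_trichotomy x 0 with h | rfl | h
    · rw [Real.sign_of_neg h, abs_of_neg h]; ring
    · simp
    · rw [Real.sign_of_pos h, abs_of_pos h]; ring
  rw [psi, hsign]
  split_ifs with hgt hlt
  · rw [abs_of_pos (by linarith), abs_of_pos (by linarith), abs_of_pos (by linarith)]; ring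
  · rw [abs_of_neg (by linarith), abs_of_neg (by linarith), abs_of_neg (by linarith)]; ring
  · rw [abs_of_nonneg (by linarith : 0 ≤ x + 1), abs_of_nonpos (by linarith : x - 1 ≤ 0)]; ring

theorem Psi_eq_abs (x : ℝ) :
    Psi x = (|x + 1| ^ 3 + |x - 1| ^ 3 - 2 * |x| ^ 3) / 12 - 1 / 6 := by
  rw [Psi]
  split_ifs with hle
  · obtain ⟨hneg, hpos⟩ := abs_le.1 hle
    rw [abs_of_nonneg (by linarith : 0 ≤ x + 1), abs_of_nonpos (by linarith : x - 1 ≤ 0)]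
    ring
  · rcases lt_abs.1 (not_le.1 hle) with h | h
    · rw [abs_of_pos (by linarith), abs_of_pos (by linarith), abs_of_pos (by linarith)]; ring
    · rw [abs_of_neg (by linarith : x < 0), abs_of_neg (by linarith), abs_of_neg (by linarith)]
      ring

/-- The triangle function, which is the derivative of `psi`. -/
noncomputable def triangle (x : ℝ) : ℝ := max 0 (1 - |x|)

theorem triangle_eq_abs (x : ℝ) : triangle x = (|x + 1| + |x - 1| - 2 * |x|) / 2 := by
  grind [triangle]

theorem triangle_nonneg (x : ℝ) : 0 ≤ triangle x := le_max_left _ _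

theorem triangle_le_one (x : ℝ) : triangle x ≤ 1 :=
  max_le zero_le_one (sub_le_self 1 (abs_nonneg x))

theorem continuous_triangle : Continuous triangle := by
  unfold triangle
  fun_prop

theorem hasDerivAt_psi (x : ℝ) : HasDerivAt psi (triangle x) x := by
  have hadd := (hasDerivAt_mul_abs (x + 1)).comp_add_const x 1
  have hsub := (hasDerivAt_mul_abs (x - 1)).comp_sub_const x 1
  rw [funext psi_eq_abs, triangle_eq_abs]
  exact (((hadd.add hsub).sub ((hasDerivAt_mul_abs x).const_mul 2)).div_const 4).congr_deriv
    (by ring)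

theorem hasDerivAt_Psi (x : ℝ) : HasDerivAt Psi (psi x) x := by
  have hadd := (hasDerivAt_abs_cube (x + 1)).comp_add_const x 1
  have hsub := (hasDerivAt_abs_cube (x - 1)).comp_sub_const x 1
  rw [funext Psi_eq_abs, psi_eq_abs]
  exact ((((hadd.add hsub).sub ((hasDerivAt_abs_cube x).const_mul 2)).div_const 12).sub_const
    (1 / 6)).congr_deriv (by ring)

theorem lipschitzWith_psi : LipschitzWith 1 psi :=
  lipschitzWith_of_nnnorm_deriv_le (fun x => (hasDerivAt_psi x).differentiableAt) fun x => by
    rw [(hasDerivAt_psi x).deriv, ← NNReal.coe_le_coe, coe_nnnorm, NNReal.coe_one,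
      Real.norm_of_nonneg (triangle_nonneg x)]
    exact triangle_le_one x

theorem convexOn_Psi : ConvexOn ℝ univ Psi := by
  refine Monotone.convexOn_univ_of_deriv (fun x => (hasDerivAt_Psi x).differentiableAt) ?_
  rw [funext fun x => (hasDerivAt_Psi x).deriv]
  exact monotone_of_hasDerivAt_nonneg hasDerivAt_psi triangle_nonneg

theorem psi_sub_psi (a b : ℝ) :
    psi a - psi b = (∫ s in (0 : ℝ)..1, triangle (s * a - (s - 1) * b)) * (a - b) := by
  have hderiv (s : ℝ) : HasDerivAt (fun s => psi (s * a - (s - 1) * b))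
      (triangle (s * a - (s - 1) * b) * (a - b)) s := by
    have hsegment : HasDerivAt (fun s : ℝ => s * a - (s - 1) * b) (a - b) s :=
      (((hasDerivAt_id s).mul_const a).sub
        (((hasDerivAt_id s).sub_const 1).mul_const b)).congr_deriv (by ring)
    exact (hasDerivAt_psi _).comp s hsegment
  have hcont : Continuous fun s : ℝ => triangle (s * a - (s - 1) * b) * (a - b) :=
    (continuous_triangle.comp (by fun_prop)).mul continuous_const
  have hftc := intervalIntegral.integral_eq_sub_of_hasDerivAt (fun s _ => hderiv s)
    (hcont.intervalIntegrable 0 1)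
  rw [intervalIntegral.integral_mul_const] at hftc
  simpa using hftc.symm

end TruncationFunction

section UnitStrip

/-- The strip of height one above the graph of `φ` over the unit interval. The area of the
intersection of two strips is an average of values of `triangle`, which realizes the divided
differences of `psi` as inner products of unit vectors. -/
def unitStrip (φ : ℝ → ℝ) : Set (ℝ × ℝ) := regionBetween φ (fun t => φ t + 1) (Ioc 0 1)

variable {φ χ : ℝ → ℝ} (hφ : Measurable φ) (hχ : Measurable χ)

include hφ in
theorem measurableSet_unitStrip : MeasurableSet (unitStrip φ) :=
  measurableSet_regionBetween hφ (hφ.add_const 1) measurableSet_Ioc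

include hφ in
theorem volume_unitStrip : volume (unitStrip φ) = 1 := by
  rw [unitStrip, Measure.volume_eq_prod,
    volume_regionBetween_eq_lintegral' hφ (hφ.add_const 1) measurableSet_Ioc]
  simp

include hφ in
theorem volume_unitStrip_ne_top : volume (unitStrip φ) ≠ ⊤ :=
  (volume_unitStrip hφ).trans_ne ENNReal.one_ne_top

theorem unitStrip_inter (φ χ : ℝ → ℝ) :
    unitStrip φ ∩ unitStrip χ =
      regionBetween (φ ⊔ χ) ((fun t => φ t + 1) ⊓ fun t => χ t + 1) (Ioc 0 1) := by
  ext p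
  simp only [unitStrip, regionBetween, mem_inter_iff, mem_ofPred_eq, mem_Ioo, Pi.sup_apply,
    Pi.inf_apply, max_lt_iff, lt_min_iff]
  tauto

include hφ hχ in
theorem volume_unitStrip_inter :
    volume.real (unitStrip φ ∩ unitStrip χ) = ∫ t in (0 : ℝ)..1, triangle (φ t - χ t) := by
  have hheight (t : ℝ) : ENNReal.ofReal (min (φ t + 1) (χ t + 1) - max (φ t) (χ t)) =
      ENNReal.ofReal (triangle (φ t - χ t)) := by
    have : triangle (φ t - χ t) = max 0 (min (φ t + 1) (χ t + 1) - max (φ t) (χ t)) := by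
      grind [triangle]
    rw [this, ENNReal.ofReal_max, ENNReal.ofReal_zero, zero_max]
  have hmeas : Measurable fun t => triangle (φ t - χ t) :=
    continuous_triangle.measurable.comp (hφ.sub hχ)
  rw [unitStrip_inter, measureReal_def, Measure.volume_eq_prod,
    volume_regionBetween_eq_lintegral' (hφ.sup hχ) ((hφ.add_const 1).inf (hχ.add_const 1))
      measurableSet_Ioc, intervalIntegral.integral_of_le zero_le_one,
    integral_eq_lintegral_of_nonneg_ae (.of_forall fun _ => triangle_nonneg _)
      hmeas.aestronglyMeasurable]
  simp only [Pi.sub_apply, Pi.sup_apply, Pi.inf_apply, hheight]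

variable (𝕜 : Type*) [RCLike 𝕜]

/-- The indicator function of a unit strip, as a unit vector of `L²`. -/
noncomputable def unitStripIndicator : Lp 𝕜 2 (volume : Measure (ℝ × ℝ)) :=
  indicatorConstLp 2 (measurableSet_unitStrip hφ) (volume_unitStrip_ne_top hφ) 1

theorem norm_unitStripIndicator : ‖unitStripIndicator hφ 𝕜‖ = 1 := by
  rw [unitStripIndicator, norm_indicatorConstLp two_ne_zero ENNReal.ofNat_ne_top, measureReal_def,
    volume_unitStrip hφ]
  simp

theorem inner_unitStripIndicator :
    inner 𝕜 (unitStripIndicator hφ 𝕜) (unitStripIndicator hχ 𝕜) =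
      ((∫ t in (0 : ℝ)..1, triangle (φ t - χ t) : ℝ) : 𝕜) := by
  rw [← volume_unitStrip_inter hφ hχ]
  exact L2.inner_indicatorConstLp_one_indicatorConstLp_one _ _
    (volume_unitStrip_ne_top hφ) (volume_unitStrip_ne_top hχ)

theorem psi_sub_psi_eq_inner_mul (a b : ℝ) :
    ((psi a - psi b : ℝ) : 𝕜) =
      inner 𝕜 (unitStripIndicator (measurable_id.mul_const a) 𝕜)
        (unitStripIndicator ((measurable_id.sub_const 1).mul_const b) 𝕜) * ((a - b : ℝ) : 𝕜) := by
  rw [inner_unitStripIndicator, psi_sub_psi, RCLike.ofReal_mul]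
  rfl

end UnitStrip

section OperatorNorm

open Matrix
open scoped Matrix.Norms.L2Operator

theorem l2_opNorm_cfc_psi_sub_cfc_psi_le {𝕜 n : Type*} [RCLike 𝕜] [Fintype n] [DecidableEq n]
    {A B : Matrix n n 𝕜} (hA : A.IsHermitian) (hB : B.IsHermitian) :
    ‖cfc psi A - cfc psi B‖ ≤ ‖A - B‖ := by
  simpa only [one_mul] using l2_opNorm_cfc_sub_cfc_le_of_gram hA hB
    (fun _ => (norm_unitStripIndicator _ 𝕜).le) (fun _ => (norm_unitStripIndicator _ 𝕜).le)
    (psi_sub_psi_eq_inner_mul 𝕜)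

end OperatorNorm

section SelfAdjointMatrices

variable {d : ℕ}

theorem isHermitian_coe (A : Herm d) : A.1.IsHermitian := A.2

theorem matFun_id (A : Herm d) : matFun (fun x => x) A = A := Subtype.ext (cfc_id' ℝ A.1 A.2)

theorem inner_eq_re_trace_mul (A B : Herm d) : inner ℝ A B = (Matrix.trace (A.1 * B.1)).re :=
  congrArg (fun M => (Matrix.trace (M * B.1)).re) A.2

theorem norm_matFun_sub_sq (f : ℝ → ℝ) (A B : Herm d) :
    ‖matFun f A - matFun f B‖ ^ 2 =
      jointSpectralSum (isHermitian_coe A) (isHermitian_coe B) fun x y => (f x - f y) ^ 2 := by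
  rw [← real_inner_self_eq_norm_sq, inner_eq_re_trace_mul]
  exact re_trace_cfc_sub_cfc_mul_self (isHermitian_coe A) (isHermitian_coe B) f

theorem norm_sub_sq_eq_jointSpectralSum (A B : Herm d) :
    ‖A - B‖ ^ 2 =
      jointSpectralSum (isHermitian_coe A) (isHermitian_coe B) fun x y => (x - y) ^ 2 := by
  simpa only [matFun_id] using norm_matFun_sub_sq (fun x => x) A B

theorem norm_matFun_sub_le {f : ℝ → ℝ} {K : NNReal} (hf : LipschitzWith K f) (A B : Herm d) :
    ‖matFun f A - matFun f B‖ ≤ K * ‖A - B‖ := by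
  refine le_of_sq_le_sq ?_ (by positivity)
  rw [mul_pow, norm_matFun_sub_sq, norm_sub_sq_eq_jointSpectralSum, ← jointSpectralSum_const_mul]
  refine jointSpectralSum_mono _ _ fun x y => ?_
  rw [← mul_pow, sq_le_sq, abs_mul, NNReal.abs_eq]
  exact hf.norm_sub_le x y

theorem opNorm_matFun_psi_sub_le (A B : Herm d) :
    opNorm (matFun psi A - matFun psi B) ≤ opNorm (A - B) :=
  l2_opNorm_cfc_psi_sub_cfc_psi_le (isHermitian_coe A) (isHermitian_coe B)

theorem convexOn_htrace_matFun {f : ℝ → ℝ} (hf : ConvexOn ℝ univ f) :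
    ConvexOn ℝ univ fun A : Herm d => htrace (matFun f A) := by
  refine convexOn_of_exists_subgradient convex_univ fun B _ =>
    ⟨innerₗ (Herm d) (matFun (fun y => derivWithin f (Ioi y) y) B), fun A _ => ?_⟩
  rw [innerₗ_apply_apply, inner_eq_re_trace_mul]
  exact klein_inequality (isHermitian_coe A) (isHermitian_coe B) (add_rightDeriv_mul_sub_le hf)

theorem hasGradientAt_htrace_matFun {f f' : ℝ → ℝ} {K : NNReal}
    (hf : ∀ x, HasDerivAt f (f' x) x) (hf' : LipschitzWith K f') (B : Herm d) :
    HasGradientAt (fun A => htrace (matFun f A)) (matFun f' B) B := by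
  refine hasGradientAt_of_abs_sub_sub_inner_le (C := K) fun A => ?_
  rw [norm_sub_sq_eq_jointSpectralSum, ← jointSpectralSum_const_mul, inner_eq_re_trace_mul]
  refine (congrArg abs
    (re_trace_cfc_sub_sub_mul (isHermitian_coe A) (isHermitian_coe B) f f')).trans_le ?_
  exact abs_jointSpectralSum_le _ _ (abs_sub_sub_mul_le_of_lipschitzWith hf hf')

theorem htrace_sum {ι : Type*} (s : Finset ι) (A : ι → Herm d) :
    htrace (∑ i ∈ s, A i) = ∑ i ∈ s, htrace (A i) := by
  simp [htrace, Matrix.trace_sum]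

/-- The operator norm, as a seminorm on the space of self-adjoint matrices. -/
noncomputable def opSeminorm (d : ℕ) : Seminorm ℝ (Herm d) :=
  Seminorm.of opNorm
    (fun A B => by
      simp only [opNorm, AddSubgroup.coe_add, map_add]
      exact norm_add_le _ _)
    (fun r A => by
      have hsmul : (r • A).1 = (r : ℂ) • A.1 := by ext; simp
      simp only [opNorm, hsmul, map_smul, norm_smul, Complex.norm_real])

end SelfAdjointMatrices

section TraceLoss

variable {d : ℕ} {ι : Type*} [Fintype ι]

/-- The total trace of `f(θ(Aᵢ - U))` over a finite family of self-adjoint matrices `Aᵢ`, as a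
function of `U`. For `f = Ψ` and the values of the kernel `H` it is the objective function. -/
noncomputable def traceLoss (f : ℝ → ℝ) (A : ι → Herm d) (θ : ℝ) (U : Herm d) : ℝ :=
  htrace (∑ i, matFun f (θ • (A i - U)))

theorem traceLoss_eq_sum (f : ℝ → ℝ) (A : ι → Herm d) (θ : ℝ) :
    traceLoss f A θ = fun U => ∑ i, htrace (matFun f (θ • (A i - U))) :=
  funext fun _ => htrace_sum _ _

theorem convexOn_traceLoss {f : ℝ → ℝ} (hf : ConvexOn ℝ univ f) (A : ι → Herm d) (θ : ℝ) :
    ConvexOn ℝ univ (traceLoss f A θ) := by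
  have hterm (i : ι) : ConvexOn ℝ univ fun U => htrace (matFun f (θ • (A i - U))) :=
    (convexOn_htrace_matFun hf).comp_affineMap
      (θ • (AffineMap.const ℝ (Herm d) (A i) - AffineMap.id ℝ (Herm d)))
  rw [traceLoss_eq_sum]
  exact convexOn_sum _ convex_univ fun i _ => hterm i

theorem hasGradientAt_traceLoss {f f' : ℝ → ℝ} {K : NNReal} (hf : ∀ x, HasDerivAt f (f' x) x)
    (hf' : LipschitzWith K f') (A : ι → Herm d) (θ : ℝ) (U : Herm d) :
    HasGradientAt (traceLoss f A θ) (-(θ • ∑ i, matFun f' (θ • (A i - U)))) U := by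
  have hsum := hasGradientAt_sum fun i =>
    hasGradientAt_comp_smul_sub (hasGradientAt_htrace_matFun hf hf' (θ • (A i - U)))
  rw [traceLoss_eq_sum]
  simpa only [Finset.smul_sum, Finset.sum_neg_distrib] using hsum

theorem seminorm_sum_comp_smul_sub_le {E : Type*} [AddCommGroup E] [Module ℝ E]
    (N : Seminorm ℝ E) {T : E → E} (hT : ∀ a b, N (T a - T b) ≤ N (a - b)) (a : ι → E) (θ : ℝ)
    (u v : E) :
    N (∑ i, T (θ • (a i - u)) - ∑ i, T (θ • (a i - v))) ≤
      Fintype.card ι * (|θ| * N (u - v)) := by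
  have hterm (i : ι) : N (T (θ • (a i - u)) - T (θ • (a i - v))) ≤ |θ| * N (u - v) := by
    refine (hT _ _).trans_eq ?_
    rw [← smul_sub, sub_sub_sub_cancel_left, map_smul_eq_mul, Real.norm_eq_abs, map_sub_rev]
  rw [← Finset.sum_sub_distrib]
  refine (Finset.le_sum_of_subadditive N (map_zero N).le (map_add_le_add N) _ _).trans ?_
  exact (Finset.sum_le_card_nsmul _ _ _ fun i _ => hterm i).trans_eq (nsmul_eq_mul _ _)

end TraceLoss

section Estimator

variable {S : Type*} {m n d : ℕ} (H : (Fin m → S) → Herm d) (x : Fin n → S) {θ : ℝ}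

theorem hasGradientAt_F (hθ : θ ≠ 0) (U : Herm d) :
    HasGradientAt (F H x θ)
      (-((1 / θ * (((n - m).factorial : ℝ) / (n.factorial : ℝ))) •
        ∑ i : Fin m ↪ Fin n, matFun psi (θ • (kernelAt H x i - U)))) U := by
  have h := hasGradientAt_const_mul (1 / θ ^ 2 * (((n - m).factorial : ℝ) / (n.factorial : ℝ)))
    (hasGradientAt_traceLoss hasDerivAt_Psi lipschitzWith_psi (kernelAt H x) θ U)
  have hscale : 1 / θ ^ 2 * (((n - m).factorial : ℝ) / (n.factorial : ℝ)) * θ =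
      1 / θ * (((n - m).factorial : ℝ) / (n.factorial : ℝ)) := by
    field_simp
  rwa [smul_neg, smul_smul, hscale] at h

theorem card_embedding_mul_factorial (hmn : m ≤ n) :
    ((n - m).factorial : ℝ) / (n.factorial : ℝ) * Fintype.card (Fin m ↪ Fin n) = 1 := by
  rw [Fintype.card_embedding_eq, Fintype.card_fin, Fintype.card_fin, div_mul_eq_mul_div,
    div_eq_one_iff_eq (by positivity)]
  exact_mod_cast Nat.factorial_mul_descFactorial hmn

theorem seminorm_gradient_F_sub_le (N : Seminorm ℝ (Herm d))
    (hN : ∀ A B : Herm d, N (matFun psi A - matFun psi B) ≤ N (A - B))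
    (hmn : m ≤ n) (hθ : θ ≠ 0) (U V : Herm d) :
    N (gradient (F H x θ) U - gradient (F H x θ) V) ≤ N (U - V) := by
  rw [(hasGradientAt_F H x hθ U).gradient, (hasGradientAt_F H x hθ V).gradient, ← neg_sub',
    ← smul_sub, map_neg_eq_map, map_smul_eq_mul]
  calc _ ≤ ‖1 / θ * (((n - m).factorial : ℝ) / (n.factorial : ℝ))‖ *
        (Fintype.card (Fin m ↪ Fin n) * (|θ| * N (U - V))) := by
        gcongr
        exact seminorm_sum_comp_smul_sub_le N hN _ θ U V
    _ = (((n - m).factorial : ℝ) / (n.factorial : ℝ) * Fintype.card (Fin m ↪ Fin n)) *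
        (|θ|⁻¹ * |θ|) * N (U - V) := by
        rw [norm_mul, one_div, norm_inv, Real.norm_eq_abs, Real.norm_of_nonneg (by positivity)]
        ring
    _ = N (U - V) := by
        rw [card_embedding_mul_factorial hmn, inv_mul_cancel₀ (abs_ne_zero.2 hθ), one_mul, one_mul]

theorem isEstimator_iff (hθ : θ ≠ 0) (U : Herm d) :
    IsEstimator H x θ U ↔
      ∑ i : Fin m ↪ Fin n, matFun psi (θ • (kernelAt H x i - U)) = 0 := by
  rw [← smul_eq_zero_iff_right hθ, ← neg_eq_zero]
  exact forall_le_iff_gradient_eq_zero (convexOn_traceLoss convexOn_Psi (kernelAt H x) θ)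
    (hasGradientAt_traceLoss hasDerivAt_Psi lipschitzWith_psi (kernelAt H x) θ U)

end Estimator

end RobustU

theorem mainTheorem8 {S : Type*} (m n d : ℕ) (hmn : m ≤ n)
    (H : (Fin m → S) → RobustU.Herm d) (x : Fin n → S) (θ : ℝ) (hθ : 0 < θ) :
    ConvexOn ℝ Set.univ (RobustU.objective H x θ) ∧
    (∀ U : RobustU.Herm d,
      HasGradientAt (RobustU.F H x θ)
        (-((1 / θ * (((n - m).factorial : ℝ) / (n.factorial : ℝ))) •
          ∑ i : Fin m ↪ Fin n,
            RobustU.matFun RobustU.psi (θ • (RobustU.kernelAt H x i - U)))) U) ∧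
    (∀ U V : RobustU.Herm d,
      ‖gradient (RobustU.F H x θ) U - gradient (RobustU.F H x θ) V‖ ≤ ‖U - V‖) ∧
    (∀ U V : RobustU.Herm d,
      RobustU.opNorm (gradient (RobustU.F H x θ) U - gradient (RobustU.F H x θ) V)
        ≤ RobustU.opNorm (U - V)) ∧
    (∀ U : RobustU.Herm d,
      RobustU.IsEstimator H x θ U ↔
        ∑ i : Fin m ↪ Fin n,
          RobustU.matFun RobustU.psi (θ • (RobustU.kernelAt H x i - U)) = 0) := by
  have hθ0 : θ ≠ 0 := hθ.ne'
  refine ⟨RobustU.convexOn_traceLoss RobustU.convexOn_Psi _ θ, RobustU.hasGradientAt_F H x hθ0,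
    ?frobenius, ?operator, RobustU.isEstimator_iff H x hθ0⟩
  case frobenius =>
    refine RobustU.seminorm_gradient_F_sub_le H x (normSeminorm ℝ _) (fun A B => ?_) hmn hθ0
    simpa using RobustU.norm_matFun_sub_le RobustU.lipschitzWith_psi A B
  case operator =>
    exact RobustU.seminorm_gradient_F_sub_le H x (RobustU.opSeminorm d)
      RobustU.opNorm_matFun_psi_sub_le hmn hθ0
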